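/- Let $\mathcal H_I$ be a Hilbert space of finite dimension $d_I$ with Hamiltonian $\hat H_I=\sum_x h_x|x\rangle\langle x|$, where $\{|x\rangle\}_x$ is an orthonormal eigenbasis. Assume that $\hat H_I$ is lattice with lattice span $h_E>0$: $h_E$ is the largest positive real number such that all differences $h_x-h_y$ are integer multiples of it (in particular $d_I\ge 2$). Let $\mathcal H_E=\ell^2(\mathbb Z)$ with orthonormal basis $\{|j\rangle\}_{j\in\mathbb Z}$, Hamiltonian $\hat H_E=\sum_j h_E\, j\,|j\rangle\langle j|$ and displacement operator $V=\sum_j|j+1\rangle\langle j|$. Let $U$ be a unitary on $\mathcal H_I\otimes\mathcal H_E$ that is shift-invariant, $U(1\otimes V)=(1\otimes V)U$, and energy-conserving, $[U,\hat H_I+\hat H_E]=0$ (that is, $U$ maps the domain of the self-adjoint operator $\hat H_I+\hat H_E$ into itself and commutes with this operator there). For a unit vector $|\psi_E\rangle\in\mathcal H_E$ put $\Lambda(A)=\operatorname{Tr}_E U(A\otimes|\psi_E\rangle\langle\psi_E|)U^\dagger$. Let $\rho_I$ be a density matrix on $\mathcal H_I$, let $|\Phi\rangle=\sum_x\sqrt{\rho_I}\,|x\rangle\otimes|x\rangle$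 be its standard purification, where the reference system $R$ is a copy of $I$, and let $\Lambda$ act on operators of $I\otimes R$ as $\Lambda\otimes\mathrm{id}_R$. The entropy exchange is $S_e(\Lambda,\rho_I)=S(\Lambda(|\Phi\rangle\langle\Phi|))$ with $S(\sigma)=-\operatorname{Tr}\sigma\log\sigma$. Let $\hat H_R=\sum_x h_x|x\rangle\langle x|$ be the copy of $\hat H_I$ on $R$, let $\hat H_I-\hat H_R=\sum_z zF_z$ be the spectral decomposition (with $F_z=0$ if $z$ is not an eigenvalue), and put $P_Z(z)=\operatorname{Tr}\Lambda(|\Phi\rangle\langle\Phi|)F_z$. Let $m,l\ge 0$ be integers with $l\le 2m+1$, and suppose that $|\psi_E\rangle=\sum_j\sqrt{P_J(j)}\,|j\rangle$ with $P_J(j)=\frac1{2m+1}$ if $|j|\le m$ and $P_J(j)=0$ otherwise, and that $P_Z(h_E j)=0$ for all $j\in\mathbb Z$ with $|j|\ge l$. Then, with $t=\frac{l}{2m+1}$ and the binary entropy $h(p)=-p\log p-(1-p)\log(1-p)$, $$S_e(\Lambda,\rho_I)\le h(2t-t^2)+(2t-t^2)\log(d_I^2-1).$$ -/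

import Mathlib

open scoped ENNReal MatrixOrder ComplexOrder

noncomputable section

namespace ShiftInvariant

/-! Finite-dimensional quantum notions.  A system with orthonormal basis `|x⟩`, `x : ι`, is `ι → ℂ`;
its operators are `Matrix ι ι ℂ`. -/

section Finite

variable {ι : Type*} [Fintype ι] [DecidableEq ι]

/-- A density matrix. -/
def IsDensity (ρ : Matrix ι ι ℂ) : Prop := ρ.PosSemidef ∧ ρ.trace = 1

open Classical in
/-- The von Neumann entropy `S(ρ) = -Tr ρ log ρ` (natural logarithm, `0 log 0 = 0`), computed from
the eigenvalues; it is only ever used for Hermitian `ρ`. -/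
def entropy (ρ : Matrix ι ι ℂ) : ℝ :=
  if hρ : ρ.IsHermitian then ∑ i, Real.negMulLog (hρ.eigenvalues i) else 0

/-- The standard purification `|Φ⟩ = ∑ x, √ρ |x⟩ ⊗ |x⟩` of `ρ`, with reference system `R` a copy of
`I`; the coordinate at `(x, r)` is `⟨x| √ρ |r⟩`. -/
def purification (ρ : Matrix ι ι ℂ) : ι × ι → ℂ := fun p => (CFC.sqrt ρ) p.1 p.2

/-- The rank one operator `|Φ⟩⟨Φ|`. -/
def ketbra {κ : Type*} (Φ : κ → ℂ) : Matrix κ κ ℂ := Matrix.vecMulVec Φ (star Φ)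

/-- The map `Λ ⊗ id_R` on operators of `I ⊗ R`. -/
def ampliate (Λ : Matrix ι ι ℂ → Matrix ι ι ℂ) (M : Matrix (ι × ι) (ι × ι) ℂ) :
    Matrix (ι × ι) (ι × ι) ℂ :=
  Matrix.of fun p q => Λ (Matrix.of fun x y => M (x, p.2) (y, q.2)) p.1 q.1

/-- The state `Λ(|Φ⟩⟨Φ|)` of `I ⊗ R` after `Λ` has acted on `I`. -/
def finalStateIR (Λ : Matrix ι ι ℂ → Matrix ι ι ℂ) (ρ : Matrix ι ι ℂ) :
    Matrix (ι × ι) (ι × ι) ℂ :=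
  ampliate Λ (ketbra (purification ρ))

/-- The entropy exchange `S_e(Λ, ρ) = S(Λ(|Φ⟩⟨Φ|))`. -/
def entropyExchange (Λ : Matrix ι ι ℂ → Matrix ι ι ℂ) (ρ : Matrix ι ι ℂ) : ℝ :=
  entropy (finalStateIR Λ ρ)

/-- The projection `F_z` in the spectral decomposition `H_I - H_R = ∑ z, z F_z`, where
`H_I = ∑ x, h x |x⟩⟨x|` and `H_R` is its copy on `R`. -/
def energyDiffProj (h : ι → ℝ) (z : ℝ) : Matrix (ι × ι) (ι × ι) ℂ :=
  Matrix.diagonal fun p => if h p.1 - h p.2 = z then 1 else 0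

/-- The distribution `P_Z(z) = Tr Λ(|Φ⟩⟨Φ|) F_z` of the energy difference. -/
def distZ (h : ι → ℝ) (Λ : Matrix ι ι ℂ → Matrix ι ι ℂ) (ρ : Matrix ι ι ℂ) (z : ℝ) : ℝ :=
  (Matrix.trace (finalStateIR Λ ρ * energyDiffProj h z)).re

/-- `d` is the lattice span of the Hamiltonian with eigenvalues `h x`: the largest positive real
of which all differences of eigenvalues are integer multiples. -/
def IsLatticeSpan (h : ι → ℝ) (d : ℝ) : Prop :=
  IsGreatest {d : ℝ | 0 < d ∧ ∀ x y, ∃ k : ℤ, h x - h y = k * d} d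

end Finite

/-! The external system `ℓ²(ℤ)` and the composite system. -/

/-- The external Hilbert space `H_E = ℓ²(ℤ)`, with basis `|j⟩`. -/
abbrev ExtSpace : Type := lp (fun _ : ℤ => ℂ) 2

/-- The Hilbert space `H_I ⊗ H_E`, as the square summable families of coordinates in the
orthonormal basis `|x⟩ ⊗ |j⟩`. -/
abbrev JointSpace (ι : Type*) : Type _ := lp (fun _ : ι × ℤ => ℂ) 2

/-- The product vector `a ⊗ ψ`. -/
def tensor {ι : Type*} [Fintype ι] (a : ι → ℂ) (ψ : ExtSpace) : JointSpace ι :=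
  ⟨fun p => a p.1 * ψ p.2, by
    refine memℓp_gen ?_
    have hψ : Summable fun j => ‖ψ j‖ ^ (2 : ℝ≥0∞).toReal := (lp.memℓp ψ).summable (by norm_num)
    have ha : Summable fun x => ‖a x‖ ^ (2 : ℝ≥0∞).toReal := (hasSum_fintype _).summable
    have := ha.mul_of_nonneg hψ (fun _ => by positivity) (fun _ => by positivity)
    refine this.congr fun p => ?_
    rw [norm_mul, Real.mul_rpow (norm_nonneg _) (norm_nonneg _)]⟩

/-- The displacement operator `1 ⊗ V`, where `V = ∑ j, |j + 1⟩⟨j|`. -/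
def shift {ι : Type*} (v : JointSpace ι) : JointSpace ι :=
  ⟨fun p => v (p.1, p.2 - 1), by
    refine memℓp_gen ?_
    have hv : Summable fun p => ‖v p‖ ^ (2 : ℝ≥0∞).toReal := (lp.memℓp v).summable (by norm_num)
    exact ((Equiv.prodCongr (Equiv.refl ι) (Equiv.subRight (1 : ℤ))).summable_iff).2 hv⟩

/-- The total Hamiltonian `H_I + H_E`, with `H_I = ∑ x, h x |x⟩⟨x|` and `H_E = ∑ j, hE j |j⟩⟨j|`, as
an unbounded self-adjoint operator on its maximal domain. -/
def totalHamiltonian {ι : Type*} (h : ι → ℝ) (hE : ℝ) : JointSpace ι →ₗ.[ℂ] JointSpace ι where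
  domain :=
    { carrier := {v | Memℓp (fun p : ι × ℤ => ((h p.1 + hE * p.2 : ℝ) : ℂ) * v p) 2}
      add_mem' := fun {v w} hv hw => by
        have := Memℓp.add hv hw
        refine (congrArg (Memℓp · 2) (funext fun p => ?_)).mp this
        simp [mul_add]
      zero_mem' := by
        refine (congrArg (Memℓp · 2) (funext fun p => ?_)).mp (zero_mem_ℓp' (p := 2))
        simp
      smul_mem' := fun c v hv => by
        have := Memℓp.const_mul hv c
        refine (congrArg (Memℓp · 2) (funext fun p => ?_)).mp this
        simp [mul_left_comm] }
  toFun :=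
    { toFun := fun v => ⟨fun p => ((h p.1 + hE * p.2 : ℝ) : ℂ) * v.1 p, v.2⟩
      map_add' := fun v w => by
        refine Subtype.ext (funext fun p => ?_)
        exact mul_add _ _ _
      map_smul' := fun c v => by
        refine Subtype.ext (funext fun p => ?_)
        exact mul_left_comm _ _ _ }

/-- `U` is shift-invariant: `U V = V U`. -/
def IsShiftInvariant {ι : Type*} (U : JointSpace ι ≃ₗᵢ[ℂ] JointSpace ι) : Prop :=
  ∀ v, U (shift v) = shift (U v)

/-- `U` is energy-conserving: `[U, H_I + H_E] = 0`, i.e. `U` preserves the domain of `H_I + H_E` and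
commutes with `H_I + H_E` there. -/
def IsEnergyConserving {ι : Type*} (h : ι → ℝ) (hE : ℝ)
    (U : JointSpace ι ≃ₗᵢ[ℂ] JointSpace ι) : Prop :=
  ∀ v : (totalHamiltonian h hE).domain, ∃ hv : U v ∈ (totalHamiltonian h hE).domain,
    totalHamiltonian h hE ⟨U v, hv⟩ = U (totalHamiltonian h hE v)

/-- The operator `K_j = ⟨j| U |ψ⟩` on `H_I`. -/
def kraus {ι : Type*} [Fintype ι] [DecidableEq ι] (U : JointSpace ι ≃ₗᵢ[ℂ] JointSpace ι)
    (ψ : ExtSpace) (j : ℤ) : Matrix ι ι ℂ :=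
  Matrix.of fun x a => U (tensor (Pi.single a 1) ψ) (x, j)

/-- The time evolution `Λ(A) = Tr_E U (A ⊗ |ψ⟩⟨ψ|) U†` of the internal system, with the partial
trace `Tr_E X = ∑ j, ⟨j| X |j⟩` taken in the basis `|j⟩`. -/
def evolution {ι : Type*} [Fintype ι] [DecidableEq ι] (U : JointSpace ι ≃ₗᵢ[ℂ] JointSpace ι)
    (ψ : ExtSpace) (A : Matrix ι ι ℂ) : Matrix ι ι ℂ :=
  Matrix.of fun x y => ∑' j : ℤ, (kraus U ψ j * A * (kraus U ψ j).conjTranspose) x y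

/-- The uniform distribution `P_J` on the `2 m + 1` levels `|j| ≤ m`. -/
def uniformDist (m : ℕ) (j : ℤ) : ℝ := if |j| ≤ m then 1 / (2 * m + 1) else 0

end ShiftInvariant

end

/-! Shift invariance and energy conservation leave `U` only the freedom of a unitary `u` on the
internal system. With energies equal to `hE * n x` up to a common constant, `U` sends |a, k⟩ to the
sum over x of u x a |x, k + n a - n x⟩ (`exists_internal_unitary`). So the Kraus operators K_j have
entries u x a * ψ (j + n x - n a), and the final state is Σ_j |v_j⟩⟨v_j|, where v_j is K_j applied
to the purification.

Summed coherently, the v_j give (Σ_j ψ j) χ, where χ is the purification rotated by `u`. By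
Cauchy–Schwarz the fidelity with χ is at least |Σ_j ψ j|² divided by the number of indices carrying
the v_j (`fidelity_ge`). The numerator is 2m+1, and the condition on P_Z confines the indices to |j|
≤ m + l (`krausVec_shiftKraus_eq_zero`). The fidelity is thus at least 1/(1+2t) ≥ (1-t)² = 1 - q
with q = 2t - t².

Fano's inequality turns this into the entropy bound, but that bound increases in q only up to 1 -
1/d_I². Beyond that point one uses that the final state is singular (`det_sum_ketbra_shiftKraus`):
its entropy is at most log(d_I² - 1), which the bound still dominates. -/

noncomputable section
namespace ShiftInvariant

/-! ### Classical Fano inequality. -/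

/-- The entropy of a subnormalised distribution on a set `s` is at most that of the uniform
distribution of the same total mass. -/
theorem sum_negMulLog_le {κ : Type*} (s : Finset κ) (hs : s.Nonempty) (p : κ → ℝ)
    (hp : ∀ i ∈ s, 0 ≤ p i) :
    ∑ i ∈ s, Real.negMulLog (p i) ≤
      Real.negMulLog (∑ i ∈ s, p i) + (∑ i ∈ s, p i) * Real.log s.card := by
  have hc : (0 : ℝ) < s.card := by exact_mod_cast hs.card_pos
  -- Jensen with equal weights 1/|s|; multiplying by |s| recovers the sum.
  have key := Real.concaveOn_negMulLog.le_map_sum (t := s) (w := fun _ => (s.card : ℝ)⁻¹) (p := p)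
    (fun _ _ => by positivity) (by simp [hc.ne']) hp
  simp only [smul_eq_mul, ← Finset.mul_sum] at key
  rw [Real.negMulLog_mul] at key
  have h2 := mul_le_mul_of_nonneg_left key hc.le
  rw [mul_inv_cancel_left₀ hc.ne'] at h2
  refine h2.trans (le_of_eq ?_)
  rw [Real.negMulLog, Real.log_inv]
  field_simp
  ring

/-- Fano's inequality: the entropy of a distribution is bounded in terms of the probability of any
one outcome. -/
theorem sum_negMulLog_le_qaryEntropy {κ : Type*} [Fintype κ] (hκ : 2 ≤ Fintype.card κ)
    (p : κ → ℝ) (hp : ∀ i, 0 ≤ p i) (hsum : ∑ i, p i = 1) (k : κ) :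
    ∑ i, Real.negMulLog (p i) ≤ Real.qaryEntropy (Fintype.card κ) (1 - p k) := by
  classical
  have hcard : (Finset.univ.erase k).card = Fintype.card κ - 1 := by
    simp [Finset.card_erase_of_mem]
  have hmass : ∑ i ∈ Finset.univ.erase k, p i = 1 - p k := by
    rw [← hsum, ← Finset.add_sum_erase _ _ (Finset.mem_univ k)]; ring
  have hcast : ((Fintype.card κ - 1 : ℕ) : ℝ) = (Fintype.card κ : ℝ) - 1 := by
    push_cast [Nat.cast_sub (by omega : 1 ≤ Fintype.card κ)]; ring
  have key := sum_negMulLog_le (Finset.univ.erase k)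
    (Finset.card_pos.mp (by rw [hcard]; omega)) p fun i _ => hp i
  rw [hmass, hcard, hcast] at key
  rw [← Finset.add_sum_erase _ _ (Finset.mem_univ k), Real.qaryEntropy,
    Real.binEntropy_eq_negMulLog_add_negMulLog_one_sub, sub_sub_cancel]
  push_cast
  linarith

/-! ### Quantum Fano inequality. -/

section Spectral

variable {κ : Type*} [Fintype κ] [DecidableEq κ]

/-- The largest eigenvalue dominates the expectation in a unit vector. -/
theorem exists_le_eigenvalue {A : Matrix κ κ ℂ} (hA : A.IsHermitian) (χ : κ → ℂ)
    (hχ : star χ ⬝ᵥ χ = 1) :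
    ∃ k, (star χ ⬝ᵥ A.mulVec χ).re ≤ hA.eigenvalues k := by
  set V : Matrix κ κ ℂ := (hA.eigenvectorUnitary : Matrix κ κ ℂ) with hV
  have hVV : V * star V = 1 := Unitary.coe_mul_star_self hA.eigenvectorUnitary
  set w : κ → ℂ := (star V).mulVec χ with hw
  have hsw : star w = Matrix.vecMul (star χ) V := by
    rw [hw, Matrix.star_mulVec, Matrix.star_eq_conjTranspose, Matrix.conjTranspose_conjTranspose]
  have hnorm : ∑ i, ‖w i‖ ^ 2 = 1 := by
    have h1 : star w ⬝ᵥ w = 1 := by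
      rw [hsw, hw, ← Matrix.dotProduct_mulVec, Matrix.mulVec_mulVec, hVV, Matrix.one_mulVec, hχ]
    have h2 : ((∑ i, ‖w i‖ ^ 2 : ℝ) : ℂ) = 1 := by
      rw [← h1]
      simp only [dotProduct, Pi.star_apply, Complex.ofReal_sum]
      refine Finset.sum_congr rfl fun i _ => ?_
      rw [RCLike.star_def, Complex.conj_mul']; push_cast; rfl
    exact_mod_cast h2
  have hexp : (star χ ⬝ᵥ A.mulVec χ).re = ∑ i, hA.eigenvalues i * ‖w i‖ ^ 2 := by
    have hAe : A = V * Matrix.diagonal (fun i => (hA.eigenvalues i : ℂ)) * star V := by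
      conv_lhs => rw [hA.spectral_theorem]
      rfl
    have h1 : star χ ⬝ᵥ A.mulVec χ =
        star w ⬝ᵥ (Matrix.diagonal fun i => (hA.eigenvalues i : ℂ)).mulVec w := by
      conv_lhs => rw [hAe]
      rw [hsw, hw, ← Matrix.dotProduct_mulVec, Matrix.mulVec_mulVec, Matrix.mulVec_mulVec,
        Matrix.mul_assoc]
    have h2 : star w ⬝ᵥ (Matrix.diagonal fun i => (hA.eigenvalues i : ℂ)).mulVec w =
        ((∑ i, hA.eigenvalues i * ‖w i‖ ^ 2 : ℝ) : ℂ) := by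
      simp only [dotProduct, Pi.star_apply, Complex.ofReal_sum, Matrix.mulVec_diagonal]
      refine Finset.sum_congr rfl fun i _ => ?_
      rw [mul_left_comm, RCLike.star_def, Complex.conj_mul']; push_cast; rfl
    rw [h1, h2, Complex.ofReal_re]
  by_contra! hlt
  have hpos : ∃ i, 0 < ‖w i‖ ^ 2 := by
    by_contra! hz
    have : ∑ i, ‖w i‖ ^ 2 ≤ 0 := Finset.sum_nonpos fun i _ => hz i
    linarith
  obtain ⟨i₀, hi₀⟩ := hpos
  have : ∑ i, hA.eigenvalues i * ‖w i‖ ^ 2 <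
      ∑ i, (star χ ⬝ᵥ A.mulVec χ).re * ‖w i‖ ^ 2 :=
    Finset.sum_lt_sum (fun i _ => mul_le_mul_of_nonneg_right (hlt i).le (by positivity))
      ⟨i₀, Finset.mem_univ _, mul_lt_mul_of_pos_right (hlt i₀) hi₀⟩
  rw [← Finset.mul_sum, hnorm, mul_one, ← hexp] at this
  exact lt_irrefl _ this

/-- The quantum Fano inequality for a singular density matrix, with no restriction on the error
probability `q`. -/
theorem entropy_le_qaryEntropy {σ : Matrix κ κ ℂ} (hσ : IsDensity σ) (hdet : σ.det = 0)
    (hκ : 2 ≤ Fintype.card κ) (χ : κ → ℂ) (hχ : star χ ⬝ᵥ χ = 1) {q : ℝ} (hq0 : 0 ≤ q)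
    (hq1 : q ≤ 1) (hF : 1 - q ≤ (star χ ⬝ᵥ σ.mulVec χ).re) :
    entropy σ ≤ Real.qaryEntropy (Fintype.card κ) q := by
  classical
  have hA : σ.IsHermitian := hσ.1.isHermitian
  have hnn : ∀ i, 0 ≤ hA.eigenvalues i := fun i => hσ.1.eigenvalues_nonneg i
  have hsum : ∑ i, hA.eigenvalues i = 1 := by
    have := hA.trace_eq_sum_eigenvalues
    rw [hσ.2] at this
    have h2 : ((∑ i, hA.eigenvalues i : ℝ) : ℂ) = 1 := by
      rw [Complex.ofReal_sum]; exact this.symm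
    exact_mod_cast h2
  have hle1 : ∀ i, hA.eigenvalues i ≤ 1 := fun i =>
    hsum ▸ Finset.single_le_sum (fun j _ => hnn j) (Finset.mem_univ i)
  have hS : ∀ k, entropy σ ≤ Real.qaryEntropy (Fintype.card κ) (1 - hA.eigenvalues k) := fun k => by
    rw [entropy, dif_pos hA]
    convert sum_negMulLog_le_qaryEntropy hκ _ hnn hsum k
  have hinv : (0 : ℝ) ≤ 1 / Fintype.card κ := by positivity
  have hinv1 : (1 : ℝ) / Fintype.card κ ≤ 1 := by
    rw [div_le_one (by exact_mod_cast (by omega : 0 < Fintype.card κ))]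
    exact_mod_cast (by omega : 1 ≤ Fintype.card κ)
  -- `Real.qaryEntropy` peaks at 1 - 1/N. Left of the peak, an eigenvalue at least 1 - q gives the
  -- bound by monotonicity; right of it, a zero eigenvalue gives the value at 1, and the function
  -- decreases towards 1.
  rcases le_total q (1 - 1 / Fintype.card κ) with hq | hq
  · obtain ⟨k, hk⟩ := exists_le_eigenvalue hA χ hχ
    refine (hS k).trans ((Real.qaryEntropy_strictMonoOn hκ).monotoneOn ⟨?_, ?_⟩ ⟨hq0, hq⟩ ?_)
    · linarith [hle1 k]
    · linarith
    · linarith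
  · have : ∃ k, hA.eigenvalues k = 0 := by
      rw [hA.det_eq_prod_eigenvalues, Finset.prod_eq_zero_iff] at hdet
      obtain ⟨k, -, hk⟩ := hdet
      exact ⟨k, Complex.ofReal_eq_zero.mp hk⟩
    obtain ⟨k, hk⟩ := this
    refine (hS k).trans ?_
    rw [hk, sub_zero]
    exact (Real.qaryEntropy_strictAntiOn hκ).antitoneOn ⟨hq, hq1⟩ ⟨by linarith, le_rfl⟩ hq1

end Spectral

/-! The structure of shift-invariant, energy-conserving unitaries. -/

section Structure

variable {ι : Type*}

/-- A Hamiltonian with a lattice span acts on a space of dimension at least two. -/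
theorem IsLatticeSpan.two_le_card [Fintype ι] {h : ι → ℝ} {d : ℝ} (hd : IsLatticeSpan h d) :
    2 ≤ Fintype.card ι := by
  by_contra! hlt
  have : Subsingleton ι := Fintype.card_le_one_iff_subsingleton.mp (by omega)
  -- With a single level every positive number is admissible, so none is greatest.
  have h2 : d + 1 ≤ d := hd.2 ⟨by linarith [hd.1.1], fun x y =>
    ⟨0, by rw [Subsingleton.elim x y]; simp⟩⟩
  linarith

/-- The energies are integer multiples of the lattice span, up to a constant. -/
theorem IsLatticeSpan.exists_levels [Fintype ι] {h : ι → ℝ} {d : ℝ} (hd : IsLatticeSpan h d) :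
    ∃ n : ι → ℤ, ∀ x y, h x - h y = ((n x - n y : ℤ) : ℝ) * d := by
  have hne : 0 < Fintype.card ι := by have := hd.two_le_card; omega
  obtain ⟨x₀⟩ := Fintype.card_pos_iff.mp hne
  choose k hk using hd.1.2
  refine ⟨fun x => k x x₀, fun x y => ?_⟩
  have h1 := hk x x₀
  have h2 := hk y x₀
  push_cast
  linarith

variable [DecidableEq ι]

/-- The basis vector `|a⟩ ⊗ |k⟩`. -/
def basisVec (a : ι) (k : ℤ) : JointSpace ι := lp.single 2 (a, k) (1 : ℂ)

theorem basisVec_apply (a : ι) (k : ℤ) (x : ι) (j : ℤ) :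
    basisVec a k (x, j) = if x = a ∧ j = k then 1 else 0 := by
  rw [basisVec, lp.single_apply, Pi.single_apply]
  simp only [Prod.mk.injEq]

theorem shift_basisVec (a : ι) (k : ℤ) : shift (basisVec a k) = basisVec a (k + 1) := by
  refine lp.ext (funext fun ⟨x, j⟩ => ?_)
  change basisVec a k (x, j - 1) = _
  rw [basisVec_apply, basisVec_apply]
  simp only [sub_eq_iff_eq_add]

variable {U : JointSpace ι ≃ₗᵢ[ℂ] JointSpace ι}

theorem IsShiftInvariant.apply_basisVec (hU : IsShiftInvariant U) (a : ι) (k : ℤ) (x : ι) (j : ℤ) :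
    U (basisVec a k) (x, j) = U (basisVec a 0) (x, j - k) := by
  have step : ∀ (k : ℤ) (j : ℤ), U (basisVec a (k + 1)) (x, j) = U (basisVec a k) (x, j - 1) :=
    fun k j => by
      rw [← shift_basisVec, hU]; rfl
  induction k generalizing j with
  | zero => rw [sub_zero]
  | succ i ih => rw [step, ih, sub_sub, add_comm (1 : ℤ)]
  | pred i ih =>
    have := step (-(i : ℤ) - 1) (j + 1)
    rw [sub_add_cancel, add_sub_cancel_right] at this
    rw [← this, ih, sub_sub_eq_add_sub, sub_neg_eq_add, add_right_comm]

/-- Basis vectors are eigenvectors of the total Hamiltonian, hence in its domain, and `U` preserves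
each eigenspace. -/
theorem IsEnergyConserving.apply_basisVec {h : ι → ℝ} {hE : ℝ} (hU : IsEnergyConserving h hE U)
    (a : ι) (k : ℤ) (x : ι) (j : ℤ) (hne : h x + hE * j ≠ h a + hE * k) :
    U (basisVec a k) (x, j) = 0 := by
  have hH : (fun p : ι × ℤ => ((h p.1 + hE * p.2 : ℝ) : ℂ) * basisVec a k p) =
      ((h a + hE * k : ℝ) : ℂ) • basisVec a k := by
    funext ⟨y, i⟩
    simp only [Pi.smul_apply, smul_eq_mul]
    rw [basisVec_apply]
    split_ifs with hyi
    · rw [hyi.1, hyi.2]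
    · simp
  have hdom : basisVec a k ∈ (totalHamiltonian h hE).domain := by
    change Memℓp (fun p : ι × ℤ => ((h p.1 + hE * p.2 : ℝ) : ℂ) * basisVec a k p) 2
    rw [hH]
    exact lp.memℓp (((h a + hE * k : ℝ) : ℂ) • basisVec a k)
  obtain ⟨hv, heq⟩ := hU ⟨basisVec a k, hdom⟩
  have hval : totalHamiltonian h hE ⟨basisVec a k, hdom⟩ =
      ((h a + hE * k : ℝ) : ℂ) • basisVec a k := lp.ext hH
  rw [hval, map_smul] at heq
  have h1 := congrArg (fun w : JointSpace ι => w (x, j)) heq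
  change ((h x + hE * j : ℝ) : ℂ) * U (basisVec a k) (x, j) =
    ((h a + hE * k : ℝ) : ℂ) * U (basisVec a k) (x, j) at h1
  by_contra hz
  exact hne (Complex.ofReal_injective (mul_right_cancel₀ hz h1))

variable [Fintype ι]

/-- The operator with entries `u x a * φ (j + n x - n a)`. -/
def shiftKraus (n : ι → ℤ) (u : Matrix ι ι ℂ) (φ : ℤ → ℂ) (j : ℤ) : Matrix ι ι ℂ :=
  Matrix.of fun x a => u x a * φ (j + n x - n a)

/-- A shift-invariant, energy-conserving unitary is determined by a unitary on the internal system: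
it raises the external energy by the internal energy lost. -/
theorem exists_internal_unitary {h : ι → ℝ} {hE : ℝ} (hE0 : 0 < hE) {n : ι → ℤ}
    (hn : ∀ x y, h x - h y = ((n x - n y : ℤ) : ℝ) * hE)
    (hshift : IsShiftInvariant U) (hcons : IsEnergyConserving h hE U) :
    ∃ u : Matrix ι ι ℂ, u.conjTranspose * u = 1 ∧
      ∀ a k x j, U (basisVec a k) (x, j) = if j + n x = k + n a then u x a else 0 := by
  -- The level n a - n x is the only one that energy conservation allows for |x⟩ when starting from
  -- |a, 0⟩.
  set u : Matrix ι ι ℂ := Matrix.of fun x a => U (basisVec a 0) (x, n a - n x) with hu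
  have hentry : ∀ a k x j,
      U (basisVec a k) (x, j) = if j + n x = k + n a then u x a else 0 := by
    intro a k x j
    split_ifs with hjk
    · rw [hshift.apply_basisVec, hu, Matrix.of_apply]
      rw [show j - k = n a - n x by omega]
    · refine hcons.apply_basisVec a k x j fun heq => hjk ?_
      have h1 := hn x a
      have h2 : ((n x - n a : ℤ) : ℝ) * hE = ((k - j : ℤ) : ℝ) * hE := by
        rw [← h1]; push_cast; linarith
      have h3 : n x - n a = k - j := by exact_mod_cast mul_right_cancel₀ hE0.ne' h2
      omega
  refine ⟨u, ?_, hentry⟩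
  -- The vectors |x, -n x⟩ span one total-energy eigenspace, on which `U` acts as `u`; preservation
  -- of inner products there makes the columns of `u` orthonormal.
  have himage : ∀ b, U (basisVec b (-n b)) = ∑ x, u x b • basisVec x (-n x) := by
    intro b
    refine lp.ext (funext fun ⟨y, j⟩ => ?_)
    rw [hentry, lp.coeFn_sum, Finset.sum_apply]
    simp only [lp.coeFn_smul, Pi.smul_apply, basisVec_apply, smul_eq_mul]
    rw [Finset.sum_eq_single y (fun x _ hx => by simp [hx.symm]) (by simp)]
    simp only [neg_add_cancel, true_and, ← eq_neg_iff_add_eq_zero]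
    split_ifs <;> simp
  ext a b
  have h1 : inner ℂ (U (basisVec a (-n a))) (U (basisVec b (-n b))) =
      inner ℂ (basisVec a (-n a)) (basisVec b (-n b)) := U.inner_map_map _ _
  rw [himage a, sum_inner] at h1
  simp only [inner_smul_left] at h1
  have h2 : ∀ (x : ι) (k : ℤ) (w : JointSpace ι), inner ℂ (basisVec x k) w = w (x, k) := by
    intro x k w
    rw [basisVec, lp.inner_single_left]; simp
  simp only [h2, hentry, basisVec_apply] at h1
  rw [Matrix.mul_apply, Matrix.one_apply]
  simp only [neg_add_cancel, if_true] at h1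
  simp only [Matrix.conjTranspose_apply, RCLike.star_def]
  rw [h1]
  congr 1
  refine propext ⟨fun h => h.1, fun h => ⟨h, by rw [h]⟩⟩

/-- Finite support of ψ lets `U` be applied term by term using linearity alone. -/
theorem tensor_single_eq_sum (a : ι) (ψ : ExtSpace) (s : Finset ℤ) (hψ : ∀ j ∉ s, ψ j = 0) :
    tensor (Pi.single a 1) ψ = ∑ k ∈ s, ψ k • basisVec a k := by
  refine lp.ext (funext fun ⟨x, j⟩ => ?_)
  change (Pi.single a (1 : ℂ) : ι → ℂ) x * ψ j = _
  rw [lp.coeFn_sum, Finset.sum_apply]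
  simp only [lp.coeFn_smul, Pi.smul_apply, basisVec_apply, smul_eq_mul, Pi.single_apply]
  by_cases hx : x = a
  · by_cases hj : j ∈ s
    · simp [hx, hj]
    · simp [hx, hj, hψ j hj]
  · simp [hx]

theorem kraus_eq_shiftKraus {n : ι → ℤ} {u : Matrix ι ι ℂ}
    (hU : ∀ a k x j, U (basisVec a k) (x, j) = if j + n x = k + n a then u x a else 0)
    (ψ : ExtSpace) (s : Finset ℤ) (hψ : ∀ j ∉ s, ψ j = 0) (j : ℤ) :
    kraus U ψ j = shiftKraus n u ψ j := by
  ext x a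
  rw [kraus, shiftKraus, Matrix.of_apply, Matrix.of_apply, tensor_single_eq_sum a ψ s hψ, map_sum,
    lp.coeFn_sum, Finset.sum_apply]
  simp only [map_smul, lp.coeFn_smul, Pi.smul_apply, hU, smul_eq_mul]
  have hk : ∀ k : ℤ, (j + n x = k + n a) ↔ (j + n x - n a = k) := fun k => by
    rw [sub_eq_iff_eq_add]
  simp only [hk, mul_ite, mul_zero, Finset.sum_ite_eq]
  split_ifs with hs
  · ring
  · rw [hψ _ hs, mul_zero]

end Structure

/-! Ensembles of Kraus vectors. -/

section Ensemble

variable {ι : Type*} [Fintype ι]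

theorem star_dotProduct_matrix (A B : Matrix ι ι ℂ) :
    (star fun p : ι × ι => A p.1 p.2) ⬝ᵥ (fun p : ι × ι => B p.1 p.2) =
      (A.conjTranspose * B).trace := by
  simp only [dotProduct, Pi.star_apply, Matrix.trace, Matrix.diag_apply, Matrix.mul_apply,
    Matrix.conjTranspose_apply]
  rw [Fintype.sum_prod_type_right]

variable [DecidableEq ι]

/-- The vector of `I ⊗ R` obtained from the purification of `ρ` by applying `K` to `I`. -/
def krausVec (K ρ : Matrix ι ι ℂ) : ι × ι → ℂ := fun p => (K * CFC.sqrt ρ) p.1 p.2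

theorem finalStateIR_evolution_apply (U : JointSpace ι ≃ₗᵢ[ℂ] JointSpace ι) (ψ : ExtSpace)
    (ρ : Matrix ι ι ℂ) (p q : ι × ι) :
    finalStateIR (evolution U ψ) ρ p q =
      ∑' j : ℤ, ketbra (krausVec (kraus U ψ j) ρ) p q := by
  rw [finalStateIR, ampliate, Matrix.of_apply, evolution, Matrix.of_apply]
  refine tsum_congr fun j => ?_
  simp only [ketbra, Matrix.vecMulVec_apply, krausVec, Pi.star_apply, Matrix.mul_apply,
    Matrix.of_apply, purification, Matrix.conjTranspose_apply, star_sum, star_mul',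
    Finset.sum_mul, Finset.mul_sum]
  refine Finset.sum_congr rfl fun a _ => Finset.sum_congr rfl fun b _ => ?_
  ring

theorem finalStateIR_evolution_eq_sum {U : JointSpace ι ≃ₗᵢ[ℂ] JointSpace ι} {ψ : ExtSpace}
    {K : ℤ → Matrix ι ι ℂ} (hK : ∀ j, kraus U ψ j = K j) (ρ : Matrix ι ι ℂ) (s : Finset ℤ)
    (hs : ∀ j ∉ s, K j = 0) :
    finalStateIR (evolution U ψ) ρ = ∑ j ∈ s, ketbra (krausVec (K j) ρ) := by
  ext p q
  rw [finalStateIR_evolution_apply, tsum_eq_sum (s := s), Matrix.sum_apply]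
  · simp only [hK]
  · intro j hj
    simp [hK, hs j hj, ketbra, krausVec, Matrix.vecMulVec_apply]

theorem ketbra_mulVec {κ : Type*} [Fintype κ] (v w : κ → ℂ) :
    (ketbra v).mulVec w = (star v ⬝ᵥ w) • v := by
  ext i
  simp only [ketbra, Matrix.mulVec, dotProduct, Matrix.vecMulVec_apply, Pi.smul_apply, smul_eq_mul,
    Finset.sum_mul]
  exact Finset.sum_congr rfl fun _ _ => by ring

theorem posSemidef_sqrt (ρ : Matrix ι ι ℂ) : (CFC.sqrt ρ).PosSemidef :=
  Matrix.nonneg_iff_posSemidef.mp (CFC.sqrt_nonneg ρ)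

theorem conjTranspose_sqrt (ρ : Matrix ι ι ℂ) : (CFC.sqrt ρ).conjTranspose = CFC.sqrt ρ :=
  (posSemidef_sqrt ρ).isHermitian

theorem IsDensity.sqrt_mul_sqrt {ρ : Matrix ι ι ℂ} (hρ : IsDensity ρ) :
    CFC.sqrt ρ * CFC.sqrt ρ = ρ :=
  CFC.sqrt_mul_sqrt_self ρ (Matrix.nonneg_iff_posSemidef.mpr hρ.1)

theorem star_krausVec_dotProduct {ρ : Matrix ι ι ℂ} (hρ : IsDensity ρ) (K : Matrix ι ι ℂ) :
    star (krausVec K ρ) ⬝ᵥ krausVec K ρ = (K.conjTranspose * K * ρ).trace := by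
  unfold krausVec
  rw [star_dotProduct_matrix, Matrix.conjTranspose_mul, conjTranspose_sqrt, Matrix.mul_assoc,
    Matrix.trace_mul_comm, Matrix.mul_assoc, Matrix.mul_assoc, hρ.sqrt_mul_sqrt, Matrix.mul_assoc]

/-- A trace preserving family of Kraus operators turns the purification into a density matrix. -/
theorem isDensity_sum_ketbra {ρ : Matrix ι ι ℂ} (hρ : IsDensity ρ) (s : Finset ℤ)
    (K : ℤ → Matrix ι ι ℂ) (hK : ∑ j ∈ s, (K j).conjTranspose * K j = 1) :
    IsDensity (∑ j ∈ s, ketbra (krausVec (K j) ρ)) := by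
  refine ⟨Matrix.posSemidef_sum _ fun j _ => Matrix.posSemidef_vecMulVec_self_star _, ?_⟩
  have h1 : ∀ j, (ketbra (krausVec (K j) ρ)).trace = ((K j).conjTranspose * K j * ρ).trace := by
    intro j
    rw [← star_krausVec_dotProduct hρ, ketbra, Matrix.trace_vecMulVec, dotProduct_comm]
  rw [Matrix.trace_sum]
  simp only [h1]
  rw [← Matrix.trace_sum, ← Matrix.sum_mul, hK, Matrix.one_mul, hρ.2]

/-- If the vectors `v j` add up to `c χ` and at most `M` of them are nonzero, then the ensemble has
fidelity at least `|c|² / M` with `χ`. -/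
theorem fidelity_ge {κ : Type*} [Fintype κ] (s t : Finset ℤ) (hts : t ⊆ s) (v : ℤ → κ → ℂ)
    (hv : ∀ j ∈ s, j ∉ t → v j = 0) (χ : κ → ℂ) (hχ : star χ ⬝ᵥ χ = 1) (c : ℂ)
    (hsum : ∑ j ∈ s, v j = c • χ) :
    ‖c‖ ^ 2 ≤ t.card * (star χ ⬝ᵥ (∑ j ∈ s, ketbra (v j)).mulVec χ).re := by
  have hF : (star χ ⬝ᵥ (∑ j ∈ s, ketbra (v j)).mulVec χ).re =
      ∑ j ∈ s, ‖star χ ⬝ᵥ v j‖ ^ 2 := by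
    have h1 : star χ ⬝ᵥ (∑ j ∈ s, ketbra (v j)).mulVec χ =
        ((∑ j ∈ s, ‖star χ ⬝ᵥ v j‖ ^ 2 : ℝ) : ℂ) := by
      rw [Matrix.sum_mulVec, dotProduct_sum, Complex.ofReal_sum]
      refine Finset.sum_congr rfl fun j _ => ?_
      rw [ketbra_mulVec, dotProduct_smul, smul_eq_mul]
      have : star (v j) ⬝ᵥ χ = star (star χ ⬝ᵥ v j) := by
        rw [Matrix.star_dotProduct]
      rw [this, RCLike.star_def, Complex.conj_mul']; push_cast; rfl
    rw [h1, Complex.ofReal_re]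
  have hrestrict : ∑ j ∈ s, ‖star χ ⬝ᵥ v j‖ ^ 2 = ∑ j ∈ t, ‖star χ ⬝ᵥ v j‖ ^ 2 :=
    (Finset.sum_subset hts fun j hj hjt => by simp [hv j hj hjt]).symm
  -- Pairing the coherent sum with χ isolates `c`; Cauchy–Schwarz over `t` then costs the factor
  -- `t.card`.
  have hc : c = ∑ j ∈ t, star χ ⬝ᵥ v j := by
    rw [← dotProduct_sum, Finset.sum_subset hts hv, hsum, dotProduct_smul, hχ, smul_eq_mul, mul_one]
  rw [hF, hrestrict]
  calc ‖c‖ ^ 2 ≤ (∑ j ∈ t, ‖star χ ⬝ᵥ v j‖) ^ 2 := by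
        rw [hc]; gcongr; exact norm_sum_le _ _
    _ ≤ _ := sq_sum_le_card_mul_sum_sq

end Ensemble

/-! Kraus operators of shift-invariant evolutions. -/

section ShiftKraus

variable {ι : Type*}

theorem sum_Icc_shift {f : ℤ → ℂ} {m L c : ℤ} (hf : ∀ j, m < |j| → f j = 0) (hL : m + |c| ≤ L) :
    ∑ j ∈ Finset.Icc (-L) L, f (j + c) = ∑ j ∈ Finset.Icc (-m) m, f j := by
  symm
  refine Finset.sum_of_injOn (fun k => k - c) (fun _ _ _ _ h => sub_left_injective h) ?_ ?_ ?_
  · intro k hk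
    simp only [Finset.coe_Icc, Set.mem_Icc] at hk ⊢
    have := le_abs_self c
    have := neg_abs_le c
    constructor <;> linarith [hk.1, hk.2]
  · intro j _ hj
    refine hf _ ?_
    by_contra! hlt
    refine hj ⟨j + c, ?_, by simp⟩
    simpa only [Finset.coe_Icc, Set.mem_Icc] using abs_le.mp hlt
  · intro k _
    simp

theorem shiftKraus_eq_zero {n : ι → ℤ} {u : Matrix ι ι ℂ} {φ : ℤ → ℂ} {m M L : ℤ}
    (hφ : ∀ j, m < |j| → φ j = 0) (hM : ∀ x a, |n x - n a| ≤ M) (hL : m + M ≤ L) {j : ℤ}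
    (hj : L < |j|) : shiftKraus n u φ j = 0 := by
  ext x a
  rw [shiftKraus, Matrix.of_apply, hφ, mul_zero, Matrix.zero_apply]
  have h1 := hM x a
  have h2 : |j| ≤ |j + n x - n a| + |n x - n a| := by
    calc |j| = |(j + n x - n a) - (n x - n a)| := by congr 1; ring
      _ ≤ _ := abs_sub _ _
  linarith

variable [Fintype ι]

/-- A common bound on the differences of levels. -/
theorem exists_level_bound (n : ι → ℤ) : ∃ M : ℤ, ∀ x a, |n x - n a| ≤ M := by
  refine ⟨∑ p : ι × ι, |n p.1 - n p.2|, fun x a => ?_⟩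
  exact Finset.single_le_sum (f := fun p : ι × ι => |n p.1 - n p.2|)
    (fun _ _ => abs_nonneg _) (Finset.mem_univ (x, a))

/-- The translates of a finitely supported sequence are linearly independent. -/
theorem sum_level_eq_zero (n : ι → ℤ) {φ : ℤ → ℂ} {m : ℤ} (hφ : ∀ j, j < -m → φ j = 0)
    (hφm : φ (-m) ≠ 0) (f : ι → ℂ) (hf : ∀ k, ∑ a, f a * φ (k - n a) = 0) (e : ℤ) :
    ∑ a with n a = e, f a = 0 := by
  by_contra he
  set T := (Finset.univ.image n).filter fun e => ∑ a with n a = e, f a ≠ 0 with hT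
  have heT : e ∈ T := by
    rw [hT, Finset.mem_filter]
    refine ⟨?_, he⟩
    by_contra hmem
    refine he (Finset.sum_eq_zero fun a ha => absurd ?_ hmem)
    exact Finset.mem_image.mpr ⟨a, Finset.mem_univ _, (Finset.mem_filter.mp ha).2⟩
  -- Take the lowest level with nonzero sum and probe it at the lower edge -m of φ: lower levels
  -- have zero sum, and higher ones meet φ below its support.
  obtain ⟨e₀, he₀, hmin⟩ := T.exists_min_image id ⟨e, heT⟩
  obtain ⟨he₀i, he₀n⟩ := Finset.mem_filter.mp he₀
  have h1 := hf (e₀ - m)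
  rw [← Finset.sum_fiberwise_of_maps_to (t := Finset.univ.image n) (g := n)
    (fun a _ => Finset.mem_image_of_mem n (Finset.mem_univ a))] at h1
  have h2 : ∀ e', ∑ a with n a = e', f a * φ (e₀ - m - n a) =
      (∑ a with n a = e', f a) * φ (e₀ - m - e') := by
    intro e'
    rw [Finset.sum_mul]
    exact Finset.sum_congr rfl fun a ha => by rw [(Finset.mem_filter.mp ha).2]
  simp only [h2] at h1
  rw [Finset.sum_eq_single_of_mem e₀ he₀i] at h1
  · rw [sub_sub_cancel_left] at h1
    exact (mul_ne_zero he₀n hφm) h1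
  · intro e' he' hne
    rcases lt_or_gt_of_ne hne with hlt | hgt
    · have : ∑ a with n a = e', f a = 0 := by
        by_contra hc
        exact absurd (hmin e' (Finset.mem_filter.mpr ⟨he', hc⟩)) (not_le.mpr hlt)
      rw [this, zero_mul]
    · rw [hφ _ (by linarith), mul_zero]

variable [DecidableEq ι]

/-- After translating j by n x - n a, the overlap of shifted copies of φ no longer depends on x, so
the sum over x is an entry of u†u. -/
theorem sum_shiftKraus_conjTranspose_mul {n : ι → ℤ} {u : Matrix ι ι ℂ}
    (hu : u.conjTranspose * u = 1) {φ : ℤ → ℂ} {m M L : ℤ} (hφ : ∀ j, m < |j| → φ j = 0)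
    (hnorm : ∑ j ∈ Finset.Icc (-m) m, star (φ j) * φ j = 1) (hM : ∀ x a, |n x - n a| ≤ M)
    (hL : m + M ≤ L) :
    ∑ j ∈ Finset.Icc (-L) L, (shiftKraus n u φ j).conjTranspose * shiftKraus n u φ j = 1 := by
  ext a b
  have hinner : ∀ x, ∑ j ∈ Finset.Icc (-L) L, star (φ (j + n x - n a)) * φ (j + n x - n b) =
      ∑ k ∈ Finset.Icc (-m) m, star (φ k) * φ (k + n a - n b) := by
    intro x
    rw [← sum_Icc_shift (f := fun k => star (φ k) * φ (k + n a - n b)) (c := n x - n a)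
      (fun j hj => by rw [hφ j hj, star_zero, zero_mul]) (by linarith [hM x a])]
    refine Finset.sum_congr rfl fun j _ => ?_
    simp only [← add_sub_assoc, sub_add_cancel]
  rw [Matrix.sum_apply]
  simp only [Matrix.mul_apply, Matrix.conjTranspose_apply, shiftKraus, Matrix.of_apply, star_mul']
  rw [Finset.sum_comm]
  have hx : ∀ x, ∑ j ∈ Finset.Icc (-L) L, star (u x a) * star (φ (j + n x - n a)) *
      (u x b * φ (j + n x - n b)) =
      star (u x a) * u x b * ∑ k ∈ Finset.Icc (-m) m, star (φ k) * φ (k + n a - n b) := by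
    intro x
    rw [← hinner x, Finset.mul_sum]
    exact Finset.sum_congr rfl fun j _ => by ring
  simp only [hx]
  rw [← Finset.sum_mul]
  have h1 : ∑ x, star (u x a) * u x b = (1 : Matrix ι ι ℂ) a b := by
    rw [← hu, Matrix.mul_apply]; rfl
  rw [h1, Matrix.one_apply]
  split_ifs with hab
  · subst hab
    simp only [add_sub_cancel_right, one_mul, hnorm]
  · rw [zero_mul]

/-- Every entry of the summed Kraus operators runs over a full translate of φ, so all the level
shifts disappear and only `u` remains. -/
theorem sum_krausVec_shiftKraus (n : ι → ℤ) (u : Matrix ι ι ℂ) {φ : ℤ → ℂ} {m M L : ℤ}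
    (hφ : ∀ j, m < |j| → φ j = 0) (hM : ∀ x a, |n x - n a| ≤ M) (hL : m + M ≤ L)
    (ρ : Matrix ι ι ℂ) :
    ∑ j ∈ Finset.Icc (-L) L, krausVec (shiftKraus n u φ j) ρ =
      (∑ j ∈ Finset.Icc (-m) m, φ j) • krausVec u ρ := by
  have hK : ∑ j ∈ Finset.Icc (-L) L, shiftKraus n u φ j =
      (∑ j ∈ Finset.Icc (-m) m, φ j) • u := by
    ext x a
    rw [Matrix.sum_apply, Matrix.smul_apply, smul_eq_mul,
      ← sum_Icc_shift (c := n x - n a) hφ (by linarith [hM x a]), Finset.sum_mul]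
    refine Finset.sum_congr rfl fun j _ => ?_
    rw [shiftKraus, Matrix.of_apply, mul_comm, add_sub_assoc]
  funext p
  have h1 : ((∑ j ∈ Finset.Icc (-L) L, shiftKraus n u φ j) * CFC.sqrt ρ) p.1 p.2 =
      (((∑ j ∈ Finset.Icc (-m) m, φ j) • u) * CFC.sqrt ρ) p.1 p.2 := by rw [hK]
  simp only [Matrix.sum_mul, Matrix.sum_apply, Matrix.smul_mul, Matrix.smul_apply] at h1
  rw [Finset.sum_apply]
  exact h1

/-- If the final energy differences of `I` and `R` are always below `l`, then so is the energy
transferred from `I`: a Kraus vector is nonzero only if `|j| < m + l`. -/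
theorem krausVec_shiftKraus_eq_zero (n : ι → ℤ) (u : Matrix ι ι ℂ) {φ : ℤ → ℂ} {m l : ℤ}
    (hφ : ∀ j, m < |j| → φ j = 0) (hφm : φ (-m) ≠ 0) (hm : 0 ≤ m) (ρ : Matrix ι ι ℂ)
    (hzero : ∀ x r, l ≤ |n x - n r| → ∀ j, krausVec (shiftKraus n u φ j) ρ (x, r) = 0)
    {j : ℤ} (hj : m + l < |j|) : krausVec (shiftKraus n u φ j) ρ = 0 := by
  set R := CFC.sqrt ρ with hR
  have hvec : ∀ j x r, krausVec (shiftKraus n u φ j) ρ (x, r) =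
      ∑ a, u x a * R a r * φ (j + n x - n a) := by
    intro j x r
    rw [krausVec, Matrix.mul_apply]
    refine Finset.sum_congr rfl fun a _ => ?_
    rw [shiftKraus, Matrix.of_apply]; ring
  -- The hypothesis compares n x with the reference level n r. Independence of translates splits it
  -- by the initial level e of I.
  have hlevel : ∀ x r, l ≤ |n x - n r| → ∀ e, ∑ a with n a = e, u x a * R a r = 0 := by
    intro x r hxr
    refine sum_level_eq_zero n (fun j hj => hφ j ?_) hφm _ fun k => ?_
    · rw [abs_of_neg (by linarith)]; linarith
    · have := hzero x r hxr (k - n x)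
      rw [hvec] at this
      simpa only [sub_add_cancel] using this
  -- Here the constraint passes from n r to e. The row of `u` cut down to level e annihilates the
  -- columns of `R` at that level, so its quadratic form in `R` vanishes; positivity of `R` then
  -- kills it against every column r.
  have hblock : ∀ x e, l ≤ |n x - e| → ∀ r, ∑ a with n a = e, u x a * R a r = 0 := by
    intro x e hxe
    set y : ι → ℂ := fun a => if n a = e then u x a else 0 with hy
    have hyR : ∀ r, Matrix.vecMul y R r = ∑ a with n a = e, u x a * R a r := by
      intro r
      rw [Matrix.vecMul, dotProduct, Finset.sum_filter]
      exact Finset.sum_congr rfl fun a _ => by rw [hy]; simp only [ite_mul, zero_mul]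
    have hquad : star (star y) ⬝ᵥ R.mulVec (star y) = 0 := by
      rw [star_star, Matrix.dotProduct_mulVec, dotProduct]
      refine Finset.sum_eq_zero fun r _ => ?_
      by_cases hr : n r = e
      · rw [hyR, hlevel x r (hr ▸ hxe), zero_mul]
      · simp [hy, hr]
    have hker := ((posSemidef_sqrt ρ).dotProduct_mulVec_zero_iff _).mp hquad
    have hker2 : Matrix.vecMul y R = 0 := by
      have := congrArg star hker
      rwa [Matrix.star_mulVec, star_star, conjTranspose_sqrt, star_zero] at this
    intro r
    rw [← hyR, hker2, Pi.zero_apply]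
  funext ⟨x, r⟩
  rw [hvec, ← Finset.sum_fiberwise_of_maps_to (t := Finset.univ.image n) (g := n)
    (fun a _ => Finset.mem_image_of_mem n (Finset.mem_univ a))]
  refine Finset.sum_eq_zero fun e _ => ?_
  have h2 : ∑ a with n a = e, u x a * R a r * φ (j + n x - n a) =
      (∑ a with n a = e, u x a * R a r) * φ (j + n x - e) := by
    rw [Finset.sum_mul]
    exact Finset.sum_congr rfl fun a ha => by rw [(Finset.mem_filter.mp ha).2]
  rw [h2]
  rcases le_or_gt l |n x - e| with hle | hlt
  · rw [hblock x e hle r, zero_mul]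
  · have h3 : |j| ≤ |j + n x - e| + |n x - e| := by
      calc |j| = |(j + n x - e) - (n x - e)| := by congr 1; ring
        _ ≤ _ := abs_sub _ _
    rw [hφ _ (by linarith), mul_zero]

theorem ketbra_mulVec_eq {κ : Type*} [Fintype κ] (T : Matrix κ κ ℂ) (v : κ → ℂ) :
    ketbra (T.mulVec v) = T * ketbra v * T.conjTranspose := by
  rw [ketbra, ketbra, Matrix.mul_vecMulVec, Matrix.vecMulVec_mul, Matrix.star_mulVec]

/-- The final state is singular: its components along the vectors `|x⟩ ⊗ |x⟩` are coherent. -/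
theorem det_sum_ketbra_shiftKraus (hι : 2 ≤ Fintype.card ι) (n : ι → ℤ) (u : Matrix ι ι ℂ)
    (φ : ℤ → ℂ) (ρ : Matrix ι ι ℂ) (s : Finset ℤ) :
    (∑ j ∈ s, ketbra (krausVec (shiftKraus n u φ j) ρ)).det = 0 := by
  -- `T` is the identity on I tensored with the transpose of √ρ on R. Pulling it out reduces
  -- singularity to the vectors of bare Kraus entries.
  set T : Matrix (ι × ι) (ι × ι) ℂ :=
    Matrix.of fun p q => if p.1 = q.1 then CFC.sqrt ρ q.2 p.2 else 0 with hT
  set w : ℤ → ι × ι → ℂ := fun j p => shiftKraus n u φ j p.1 p.2 with hw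
  have hvec : ∀ j, krausVec (shiftKraus n u φ j) ρ = T.mulVec (w j) := by
    intro j
    funext ⟨x, r⟩
    rw [krausVec, Matrix.mul_apply, Matrix.mulVec, dotProduct, Fintype.sum_prod_type]
    symm
    rw [Finset.sum_eq_single x]
    · refine Finset.sum_congr rfl fun a _ => ?_
      simp only [hT, hw, Matrix.of_apply, if_true, mul_comm]
    · intro y _ hy
      simp [hT, hy.symm]
    · simp
  have hfactor : ∑ j ∈ s, ketbra (krausVec (shiftKraus n u φ j) ρ) =
      T * (∑ j ∈ s, ketbra (w j)) * T.conjTranspose := by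
    rw [Matrix.mul_sum, Matrix.sum_mul]
    exact Finset.sum_congr rfl fun j _ => by rw [hvec, ketbra_mulVec_eq]
  suffices h0 : (∑ j ∈ s, ketbra (w j)).det = 0 by
    rw [hfactor, Matrix.det_mul, Matrix.det_mul, h0, mul_zero, zero_mul]
  refine Matrix.exists_mulVec_eq_zero_iff.mp ?_
  suffices hy : ∃ y : ι × ι → ℂ, y ≠ 0 ∧ ∀ j, star (w j) ⬝ᵥ y = 0 by
    obtain ⟨y, hy0, hy⟩ := hy
    refine ⟨y, hy0, ?_⟩
    rw [Matrix.sum_mulVec]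
    exact Finset.sum_eq_zero fun j _ => by rw [ketbra_mulVec, hy, zero_smul]
  obtain ⟨x, x', hxx⟩ := Fintype.one_lt_card_iff.mp hι
  have hdiag : ∀ j z, w j (z, z) = u z z * φ j := fun j z => by
    simp only [hw, shiftKraus, Matrix.of_apply, add_sub_cancel_right]
  -- The diagonal entries at x and x' are both fixed multiples of φ j, so a single vector on these
  -- two coordinates is orthogonal to every `w j`.
  by_cases hux : u x x = 0
  · refine ⟨Pi.single (x, x) 1, fun h => ?_, fun j => ?_⟩
    · simpa using congrFun h (x, x)
    · simp [hdiag, hux]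
  · refine ⟨Pi.single (x, x) (star (u x' x')) - Pi.single (x', x') (star (u x x)), fun h => ?_,
      fun j => ?_⟩
    · have := congrFun h (x', x')
      simp [hxx.symm, hux] at this
    · rw [dotProduct_sub, dotProduct_single, dotProduct_single, Pi.star_apply, Pi.star_apply, hdiag,
        hdiag, star_mul', star_mul']
      ring

/-- Vanishing of the distribution of the energy difference at `z` forces the Kraus vectors to vanish
there. -/
theorem krausVec_eq_zero_of_distZ {Λ : Matrix ι ι ℂ → Matrix ι ι ℂ} {ρ : Matrix ι ι ℂ}
    {v : ℤ → ι × ι → ℂ} {s : Finset ℤ} (hσ : finalStateIR Λ ρ = ∑ j ∈ s, ketbra (v j))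
    {h : ι → ℝ} {z : ℝ} (hz : distZ h Λ ρ z = 0) {x r : ι} (hxr : h x - h r = z) {j : ℤ}
    (hj : j ∈ s) : v j (x, r) = 0 := by
  have hexp : distZ h Λ ρ z =
      ∑ p : ι × ι, if h p.1 - h p.2 = z then ∑ j ∈ s, ‖v j p‖ ^ 2 else 0 := by
    rw [distZ, hσ, energyDiffProj, Matrix.trace, Complex.re_sum]
    refine Finset.sum_congr rfl fun p _ => ?_
    rw [Matrix.diag_apply, Matrix.mul_diagonal]
    split_ifs with hp
    · rw [mul_one, Matrix.sum_apply, Complex.re_sum]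
      refine Finset.sum_congr rfl fun i _ => ?_
      rw [ketbra, Matrix.vecMulVec_apply, Pi.star_apply, RCLike.star_def, Complex.mul_conj',
        ← Complex.ofReal_pow, Complex.ofReal_re]
    · simp
  rw [hexp, Finset.sum_eq_zero_iff_of_nonneg (fun p _ => by positivity)] at hz
  have h1 := hz (x, r) (Finset.mem_univ _)
  rw [if_pos hxr, Finset.sum_eq_zero_iff_of_nonneg (fun p _ => by positivity)] at h1
  simpa using h1 j hj

end ShiftKraus

end ShiftInvariant
end

/-! ### Assembly of the entropy exchange bound. -/

open ShiftInvariant in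
theorem mainTheorem7 {ι : Type*} [Fintype ι] [DecidableEq ι]
    (h : ι → ℝ) (hE : ℝ) (hspan : IsLatticeSpan h hE)
    (U : JointSpace ι ≃ₗᵢ[ℂ] JointSpace ι)
    (hshift : IsShiftInvariant U) (hcons : IsEnergyConserving h hE U)
    (ρ : Matrix ι ι ℂ) (hρ : IsDensity ρ)
    (m l : ℕ) (hl : l ≤ 2 * m + 1)
    (ψ : ExtSpace) (hψ : ∀ j : ℤ, ψ j = ((√(uniformDist m j) : ℝ) : ℂ))
    (hZ : ∀ j : ℤ, (l : ℤ) ≤ |j| → distZ h (evolution U ψ) ρ (hE * j) = 0)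
    (t : ℝ) (ht : t = (l : ℝ) / (2 * m + 1)) :
    entropyExchange (evolution U ψ) ρ ≤
      Real.binEntropy (2 * t - t ^ 2) +
        (2 * t - t ^ 2) * Real.log ((Fintype.card ι : ℝ) ^ 2 - 1) := by
  have hι := hspan.two_le_card
  obtain ⟨n, hn⟩ := hspan.exists_levels
  obtain ⟨M, hM⟩ := exists_level_bound n
  obtain ⟨u, hu, hU⟩ := exists_internal_unitary hspan.1.1 hn hshift hcons
  have hN : (0 : ℝ) < 2 * m + 1 := by positivity
  have hin : ∀ j : ℤ, |j| ≤ m → ψ j = ((√(1 / (2 * m + 1)) : ℝ) : ℂ) := fun j hj => by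
    rw [hψ, uniformDist, if_pos hj]
  have hout : ∀ j : ℤ, (m : ℤ) < |j| → ψ j = 0 := fun j hj => by
    rw [hψ, uniformDist, if_neg (not_le.mpr hj), Real.sqrt_zero, Complex.ofReal_zero]
  have hψm : ψ (-(m : ℤ)) ≠ 0 := by
    rw [hin _ (by simp)]
    exact Complex.ofReal_ne_zero.mpr (by positivity)
  have hcard : (Finset.Icc (-(m : ℤ)) m).card = 2 * m + 1 := by
    rw [Int.card_Icc]; omega
  have hconst : ∀ f : ℂ → ℂ, ∑ j ∈ Finset.Icc (-(m : ℤ)) m, f (ψ j) =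
      (2 * m + 1) * f ((√(1 / (2 * m + 1)) : ℝ) : ℂ) := fun f => by
    rw [Finset.sum_congr rfl fun j hj => by rw [hin j (abs_le.mpr (Finset.mem_Icc.mp hj))],
      Finset.sum_const, hcard, nsmul_eq_mul]
    push_cast; rfl
  have hnorm : ∑ j ∈ Finset.Icc (-(m : ℤ)) m, star (ψ j) * ψ j = 1 := by
    rw [hconst fun z => star z * z, RCLike.star_def, Complex.conj_ofReal, ← Complex.ofReal_mul,
      Real.mul_self_sqrt (by positivity)]
    push_cast
    exact mul_one_div_cancel (by exact_mod_cast hN.ne')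
  -- A window wide enough for all nonzero Kraus operators and for the index set |j| ≤ m + l used in
  -- the fidelity estimate.
  set L : ℤ := max (m + M) (m + l) with hL
  have hLM : (m : ℤ) + M ≤ L := le_max_left _ _
  set K := shiftKraus n u ψ with hK
  have hkraus : ∀ j, kraus U ψ j = K j :=
    kraus_eq_shiftKraus hU ψ (Finset.Icc (-(m : ℤ)) m) fun j hj => hout j
      (not_le.mp fun hle => hj (Finset.mem_Icc.mpr (abs_le.mp hle)))
  have hKout : ∀ j ∉ Finset.Icc (-L) L, K j = 0 := fun j hj =>
    shiftKraus_eq_zero hout hM hLM (not_le.mp fun hle => hj (Finset.mem_Icc.mpr (abs_le.mp hle)))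
  have hσ := finalStateIR_evolution_eq_sum hkraus ρ _ hKout
  have hdens := isDensity_sum_ketbra hρ _ K
    (sum_shiftKraus_conjTranspose_mul hu hout hnorm hM hLM)
  have hdet := det_sum_ketbra_shiftKraus hι n u ψ ρ (Finset.Icc (-L) L)
  have hzero : ∀ x r, (l : ℤ) ≤ |n x - n r| → ∀ j, krausVec (K j) ρ (x, r) = 0 := by
    intro x r hxr j
    by_cases hj : j ∈ Finset.Icc (-L) L
    · exact krausVec_eq_zero_of_distZ hσ (hZ _ hxr) (by rw [hn, mul_comm]) hj
    · simp [krausVec, hKout j hj]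
  have hχ : star (krausVec u ρ) ⬝ᵥ krausVec u ρ = 1 := by
    rw [star_krausVec_dotProduct hρ, hu, Matrix.one_mul, hρ.2]
  have hF := fidelity_ge (Finset.Icc (-L) L) (Finset.Icc (-((m : ℤ) + l)) (m + l))
    (Finset.Icc_subset_Icc (neg_le_neg (le_max_right _ _)) (le_max_right _ _))
    (fun j => krausVec (K j) ρ)
    (fun j _ hj => krausVec_shiftKraus_eq_zero n u hout hψm (by positivity) ρ hzero
      (not_le.mp fun hle => hj (Finset.mem_Icc.mpr (abs_le.mp hle))))
    (krausVec u ρ) hχ _ (sum_krausVec_shiftKraus n u hout hM hLM ρ)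
  have hcard2 : ((Finset.Icc (-((m : ℤ) + l)) (m + l)).card : ℝ) = 2 * m + 1 + 2 * l := by
    have : (Finset.Icc (-((m : ℤ) + l)) (m + l)).card = 2 * m + 1 + 2 * l := by
      rw [Int.card_Icc]; omega
    rw [this]; push_cast; rfl
  have hc : ‖∑ j ∈ Finset.Icc (-(m : ℤ)) m, ψ j‖ ^ 2 = 2 * m + 1 := by
    rw [hconst fun z => z, norm_mul, mul_pow, Complex.norm_real, Real.norm_eq_abs, sq_abs,
      Real.sq_sqrt (by positivity)]
    have : ‖(2 * m + 1 : ℂ)‖ = 2 * m + 1 := by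
      rw [show (2 * m + 1 : ℂ) = ((2 * m + 1 : ℝ) : ℂ) by push_cast; rfl, Complex.norm_real,
        Real.norm_of_nonneg hN.le]
    rw [this]; field_simp
  rw [hc, hcard2] at hF
  have hlN : (l : ℝ) = t * (2 * m + 1) := by rw [ht]; field_simp
  have ht0 : 0 ≤ t := by rw [ht]; positivity
  have ht1 : t ≤ 1 := by
    rw [ht, div_le_one hN]; exact_mod_cast hl
  have hfid : 1 - (2 * t - t ^ 2) ≤ (star (krausVec u ρ) ⬝ᵥ
      (∑ j ∈ Finset.Icc (-L) L, ketbra (krausVec (K j) ρ)).mulVec (krausVec u ρ)).re := by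
    set F := (star (krausVec u ρ) ⬝ᵥ
      (∑ j ∈ Finset.Icc (-L) L, ketbra (krausVec (K j) ρ)).mulVec (krausVec u ρ)).re
    rw [hlN, show 2 * (m : ℝ) + 1 + 2 * (t * (2 * m + 1)) = (2 * m + 1) * (1 + 2 * t) by ring,
      mul_assoc] at hF
    have h1 : 1 ≤ (1 + 2 * t) * F := le_of_mul_le_mul_left (by rwa [mul_one]) hN
    -- The left side is (1 + 2t)(1 - t)² = 1 - 3t² + 2t³, and t ≤ 1.
    have h2 : (1 + 2 * t) * (1 - (2 * t - t ^ 2)) ≤ 1 := by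
      nlinarith [mul_nonneg (sq_nonneg t) (sub_nonneg.mpr ht1), sq_nonneg t]
    exact le_of_mul_le_mul_left (h2.trans h1) (by positivity)
  rw [entropyExchange, hσ]
  have hι2 : 2 ≤ Fintype.card (ι × ι) := by
    rw [Fintype.card_prod]; nlinarith
  have hfinal := entropy_le_qaryEntropy hdens hdet hι2 (krausVec u ρ) hχ
    (q := 2 * t - t ^ 2) (by nlinarith) (by nlinarith [sq_nonneg (1 - t)]) hfid
  refine hfinal.trans (le_of_eq ?_)
  rw [Real.qaryEntropy, Fintype.card_prod, add_comm]
  push_cast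
  rw [pow_two (Fintype.card ι : ℝ)]
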